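/- Conventions. Composition is written in diagrammatic order ($fg$ is $f$ followed by $g$). An additive bundle $(q:E\to M,\sigma,\zeta)$ is a map $q$ all of whose finite pullback powers $E_n$ along itself exist, together with $\sigma:E_2\to E$ and $\zeta:M\to E$ making $q$ a commutative monoid in the slice over $M$; a commutative square $(e,b):q\to q'$ is an additive bundle morphism if $e_2\sigma'=\sigma e$ and $b\zeta'=\zeta e$. A *tangent structure* on a category $\mathbb X$ consists of a functor $T:\mathbb X\to\mathbb X$; natural transformations $p:T\to 1$, $0:1\to T$, $+:T_2\to T$ making each $p_M$ an additive bundle whose finite pullback powers are preserved by each $T^n$; a vertical lift $\ell:T\to T^2$ and a canonical flip $c:T^2\to T^2$, natural and such that $(\ell_M,0_M):(p_M,+,0)\to(T(p_M),T(+),T(0))$ and $(c_M,1):(T(p_M),T(+),T(0))\to(p_{TM},+,0)$ are additive bundle morphisms, $cc=1$, $\ell c=\ell$, $\ell T(\ell)=\ell\ell_T$, $T(c)c_TT(c)=c_TT(c)c_T$, $cT(\ell)=\ell_TT(c)c_T$; and, with $v=\langle\pi_0\ell,\pi_1 0_T\rangle T(+)$, the square $v\,T(p)=(\pi_0p)\,0$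 is a pullback preserved by each $T^n$. The tangent category is *Cartesian* if $\mathbb X$ has finite products and $T$ preserves them. A *differential bundle* is an additive bundle $(q:E\to M,\sigma,\zeta)$ whose finite pullback powers are preserved by each $T^n$, with a lift $\lambda:E\to T(E)$ such that $(\lambda,0):q\to T(q)$ and $(\lambda,\zeta):q\to p_E$ are additive bundle morphisms, $\lambda\ell=\lambda T(\lambda)$, and, with $\mu:=\langle\pi_0\lambda,\pi_10\rangle T(\sigma):E_2\to T(E)$, the square $\mu\,T(q)=(\pi_0q)\,0$ is a pullback preserved by each $T^n$. For $f:X\to T(E)$ with $fT(q)=fpq0$, write $\{f\}:X\to E$ for the unique map with $f=\langle\{f\}\lambda,fp0\rangle T(\sigma)$. A Cartesian tangent category has *coherent differential structure* if every object $A$ is equipped with a structure $(!_A,\zeta_A,\sigma_A,\lambda_A)$ of differential bundle over the final object $1$ (so $\sigma_A:A\times A\to A$, $\zeta_A:1\to A$, $\lambda_A:A\to T(A)$) such that, where $\mathsf{ex}$ exchanges the two middle factors, $m^T_1:1\to T(1)$ is the inverse of $!_{T(1)}$ and $m^T_\times=\langle T(\pi_0),T(\pi_1)\rangle^{-1}$,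 for all objects $A,B$: * [CDS.1] $\zeta_{A\times B}=\langle\zeta_A,\zeta_B\rangle$, $\sigma_{A\times B}=\mathsf{ex}(\sigma_A\times\sigma_B)$, $\lambda_{A\times B}=(\lambda_A\times\lambda_B)m^T_\times$; * [CDS.2] $\zeta_{T(A)}=m^T_1T(\zeta_A)$, $\sigma_{T(A)}=m^T_\times T(\sigma_A)$, $\lambda_{T(A)}=T(\lambda_A)c$. Write $\mu_A:A\times A\to T(A)$ for the map $\mu$ of this bundle and $\hat p_A:=\{1_{T(A)}\}:T(A)\to A$. **Theorem.** Let $\mathbb X$ be a Cartesian tangent category with a coherent differential structure. Define, for parallel maps $f,g:A\to B$, $$f+g:=\langle f,g\rangle\sigma_B,\qquad 0:=\,!_A\zeta_B,\qquad D[f]:=\mu_A\,T(f)\,\hat p_B:A\times A\to B .$$ Then $\mathbb X$ is a Cartesian left additive category: every hom-set is a commutative monoid under $+,0$, $f(h+k)=fh+fk$ and $f0=0$, and the projections are additive, i.e. $(f+g)\pi_i=f\pi_i+g\pi_i$ and $0\pi_i=0$. Moreover $\mathbb X$ with $D$ is a Cartesian differential category: * [CD.1] $D[f+g]=D[f]+D[g]$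 and $D[0]=0$; * [CD.2] $\langle a+b,c\rangle D[f]=\langle a,c\rangle D[f]+\langle b,c\rangle D[f]$ and $\langle 0,a\rangle D[f]=0$; * [CD.3] $D[\pi_0]=\pi_0\pi_0$ and $D[\pi_1]=\pi_0\pi_1$; * [CD.4] $D[\langle f,g\rangle]=\langle D[f],D[g]\rangle$; * [CD.5] $D[fg]=\langle D[f],\pi_1f\rangle D[g]$; * [CD.6] $\langle\langle a,0\rangle,\langle 0,d\rangle\rangle D[D[f]]=\langle a,d\rangle D[f]$; * [CD.7] $\langle\langle a,b\rangle,\langle c,d\rangle\rangle D[D[f]]=\langle\langle a,c\rangle,\langle b,d\rangle\rangle D[D[f]]$. -/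

import Mathlib

open CategoryTheory CategoryTheory.Limits MonoidalCategory CartesianMonoidalCategory

universe v u

namespace Tangent

noncomputable section

/-! ### Additive bundles -/

section Bundles

variable {C : Type u} [Category.{v} C]

/-- The `n`-fold iterate `Tⁿ` of an endofunctor. -/
def iter (T : C ⥤ C) : ℕ → (C ⥤ C)
  | 0 => 𝟭 C
  | n + 1 => iter T n ⋙ T

/-- All finite pullback powers of `q : E ⟶ M` along itself exist and are preserved by
each `Tᵐ`. -/
structure AdmitsPullbackPowers (T : C ⥤ C) {E M : C} (q : E ⟶ M) : Prop where
  hasPower : ∀ n : ℕ, HasWidePullback M (fun _ : Fin n => E) (fun _ => q)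
  preservesPower : ∀ n m : ℕ,
    PreservesLimit (WidePullbackShape.wideCospan M (fun _ : Fin n => E) (fun _ => q)) (iter T m)

/-- A functor preserving the second pullback power of `q` preserves every pullback square
of `q` along itself. -/
theorem isPullback_map_of_preserves (F : C ⥤ C) {E M P : C} {q : E ⟶ M} {a b : P ⟶ E}
    (h : IsPullback a b q q)
    (hF : PreservesLimit (WidePullbackShape.wideCospan M (fun _ : Fin 2 => E) (fun _ => q)) F) :
    IsPullback (F.map a) (F.map b) (F.map q) (F.map q) := by
  let D := WidePullbackShape.wideCospan M (fun _ : Fin 2 => E) (fun _ => q)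
  let c : Cone D := WidePullbackShape.mkCone (F := D) (X := P) (a ≫ q) ![a, b]
    (by intro j; fin_cases j
        · rfl
        · exact h.w.symm)
  -- two maps into a cone over a wide cospan agree on the base if they agree on a leg
  have base : ∀ {G : WidePullbackShape (Fin 2) ⥤ C} (t : Cone G) {X : C} (x : X ⟶ t.pt)
      (y : X ⟶ G.obj (some 0)), x ≫ t.π.app (some 0) = y →
      x ≫ t.π.app none = y ≫ G.map (WidePullbackShape.Hom.term (0 : Fin 2)) := by
    intro G t X x y hxy
    rw [← t.w (WidePullbackShape.Hom.term (0 : Fin 2)), ← hxy, Category.assoc]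
  have hw : ∀ s : Cone D, (s.π.app (some 0) : s.pt ⟶ E) ≫ q = (s.π.app (some 1) : s.pt ⟶ E) ≫ q :=
    fun s => (s.w (WidePullbackShape.Hom.term (0 : Fin 2))).trans
      (s.w (WidePullbackShape.Hom.term (1 : Fin 2))).symm
  have hc : IsLimit c :=
    { lift := fun s => h.lift (s.π.app (some 0)) (s.π.app (some 1)) (hw s)
      fac := by
        intro s j
        cases j with
        | none =>
          exact (base c _ _ (h.lift_fst _ _ (hw s))).trans
            (s.w (WidePullbackShape.Hom.term (0 : Fin 2)))
        | some j =>
          fin_cases j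
          · exact h.lift_fst _ _ (hw s)
          · exact h.lift_snd _ _ (hw s)
      uniq := by
        intro s m hm
        exact h.hom_ext ((hm (some 0)).trans (h.lift_fst _ _ (hw s)).symm)
          ((hm (some 1)).trans (h.lift_snd _ _ (hw s)).symm) }
  have hL := isLimitOfPreserves F hc
  have w : F.map a ≫ F.map q = F.map b ≫ F.map q := by rw [← F.map_comp, h.w, F.map_comp]
  let d : PullbackCone (F.map q) (F.map q) → Cone (D ⋙ F) := fun s =>
    WidePullbackShape.mkCone (F := D ⋙ F) (X := s.pt) (s.fst ≫ F.map q) ![s.fst, s.snd]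
      (by intro j; fin_cases j
          · rfl
          · exact s.condition.symm)
  refine ⟨⟨w⟩, ⟨PullbackCone.IsLimit.mk w (fun s => hL.lift (d s)) (fun s => hL.fac (d s) (some 0))
    (fun s => hL.fac (d s) (some 1)) ?_⟩⟩
  intro s m h₁ h₂
  refine hL.uniq (d s) m fun j => ?_
  cases j with
  | none => exact base (F.mapCone c) m s.fst h₁
  | some j =>
    fin_cases j
    · exact h₁
    · exact h₂

/-- The data of an addition and a zero on `q : E ⟶ M`: the pullback `E₂` of `q` along itself,
with projections `π₀, π₁`, an addition `E₂ ⟶ E` and a zero `M ⟶ E`. -/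
structure BundleData {E M : C} (q : E ⟶ M) where
  obj₂ : C
  π₀ : obj₂ ⟶ E
  π₁ : obj₂ ⟶ E
  isPullback : IsPullback π₀ π₁ q q
  add : obj₂ ⟶ E
  zero : M ⟶ E

/-- The sum `⟨x, y⟩σ` of two generalized elements of `E` in the same fibre. -/
def BundleData.sum {E M : C} {q : E ⟶ M} (b : BundleData q) {X : C} (x y : X ⟶ E)
    (h : x ≫ q = y ≫ q) : X ⟶ E :=
  b.isPullback.lift x y h ≫ b.add

theorem BundleData.sum_comp {E M : C} {q : E ⟶ M} (b : BundleData q)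
    (hb : b.add ≫ q = b.π₀ ≫ q) {X : C} (x y : X ⟶ E) (h : x ≫ q = y ≫ q) :
    b.sum x y h ≫ q = x ≫ q := by
  rw [BundleData.sum, Category.assoc, hb, b.isPullback.lift_fst_assoc]

/-- `(q, σ, ζ)` is a commutative monoid in the slice category over `M`
(laws expressed on generalized elements of `E` lying in one fibre). -/
structure BundleData.IsCommMonoid {E M : C} {q : E ⟶ M} (b : BundleData q) : Prop where
  add_comp : b.add ≫ q = b.π₀ ≫ q
  zero_comp : b.zero ≫ q = 𝟙 M
  zero_add : ∀ {X : C} (x : X ⟶ E),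
    b.sum (x ≫ q ≫ b.zero) x (by simp [zero_comp]) = x
  add_comm : ∀ {X : C} (x y : X ⟶ E) (h : x ≫ q = y ≫ q), b.sum x y h = b.sum y x h.symm
  add_assoc : ∀ {X : C} (x y z : X ⟶ E) (hxy : x ≫ q = y ≫ q) (hyz : y ≫ q = z ≫ q),
    b.sum (b.sum x y hxy) z ((b.sum_comp add_comp x y hxy).trans (hxy.trans hyz)) =
      b.sum x (b.sum y z hyz) (hxy.trans (b.sum_comp add_comp y z hyz).symm)

/-- An additive bundle: `q` admits finite pullback powers and is a commutative monoid over `M`.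
The powers are moreover required to be preserved by each `Tⁿ`. -/
structure BundleData.IsAdditiveBundle (T : C ⥤ C) {E M : C} {q : E ⟶ M} (b : BundleData q) :
    Prop where
  powers : AdmitsPullbackPowers T q
  isCommMonoid : b.IsCommMonoid

/-- `(e, m) : q ⟶ q'` is a commutative square preserving addition and zero. -/
structure IsAdditiveMorphism {E M E' M' : C} {q : E ⟶ M} {q' : E' ⟶ M'}
    (b : BundleData q) (b' : BundleData q') (e : E ⟶ E') (m : M ⟶ M') : Prop where
  comm : e ≫ q' = q ≫ m
  map_add : b'.isPullback.lift (b.π₀ ≫ e) (b.π₁ ≫ e)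
      (by rw [Category.assoc, Category.assoc, comm, b.isPullback.w_assoc]) ≫ b'.add = b.add ≫ e
  map_zero : m ≫ b'.zero = b.zero ≫ e

/-- The image `(T(q), T(σ), T(ζ))` of bundle data, with `T(E)₂ = T(E₂)`. -/
def BundleData.map {T : C ⥤ C} {E M : C} {q : E ⟶ M} (b : BundleData q)
    (h : AdmitsPullbackPowers T q) : BundleData (T.map q) where
  obj₂ := T.obj b.obj₂
  π₀ := T.map b.π₀
  π₁ := T.map b.π₁
  isPullback := isPullback_map_of_preserves (iter T 1) b.isPullback (h.preservesPower 2 1)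
  add := T.map b.add
  zero := T.map b.zero

end Bundles

/-! ### Tangent categories -/

section TangentCategories

/-- The tangent functor `T`, its projection `p`, and its additive bundle structure `+`, `0`. -/
structure TangentBundleFunctor (C : Type u) [Category.{v} C] where
  T : C ⥤ C
  p : T ⟶ 𝟭 C
  bundle : ∀ M : C, BundleData (p.app M)
  isAdditive : ∀ M : C, (bundle M).IsAdditiveBundle T
  zero_naturality : ∀ {M N : C} (f : M ⟶ N),
    f ≫ (bundle N).zero = (bundle M).zero ≫ T.map f
  add_naturality : ∀ {M N : C} (f : M ⟶ N),
    (bundle N).isPullback.lift ((bundle M).π₀ ≫ T.map f) ((bundle M).π₁ ≫ T.map f)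
      (by
        rw [Category.assoc, Category.assoc, p.naturality, (bundle M).isPullback.w_assoc]) ≫
      (bundle N).add = (bundle M).add ≫ T.map f

variable {C : Type u} [Category.{v} C]

/-- The zero section `0_M : M ⟶ T(M)`. -/
def TangentBundleFunctor.zero (𝕋 : TangentBundleFunctor C) (M : C) : M ⟶ 𝕋.T.obj M :=
  (𝕋.bundle M).zero

/-- The bundle data `(T(p_M), T(+_M), T(0_M))`. -/
def TangentBundleFunctor.mapBundle (𝕋 : TangentBundleFunctor C) (M : C) :
    BundleData (𝕋.T.map (𝕋.p.app M)) :=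
  (𝕋.bundle M).map (𝕋.isAdditive M).powers

/-- `μ := ⟨π₀λ, π₁0⟩T(σ) : E₂ ⟶ T(E)`, for bundle data on `q` and a lift `λ : E ⟶ T(E)`
lying over the zero section of `T(M)`. -/
def TangentBundleFunctor.mu (𝕋 : TangentBundleFunctor C) {E M : C} {q : E ⟶ M}
    (b : BundleData q) (hq : AdmitsPullbackPowers 𝕋.T q) (lam : E ⟶ 𝕋.T.obj E)
    (hlam : lam ≫ 𝕋.T.map q = q ≫ 𝕋.zero M) : b.obj₂ ⟶ 𝕋.T.obj E :=
  (b.map hq).isPullback.lift (b.π₀ ≫ lam) (b.π₁ ≫ 𝕋.zero E)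
    (by
      have h : 𝕋.zero E ≫ 𝕋.T.map q = q ≫ 𝕋.zero M := (𝕋.zero_naturality q).symm
      rw [Category.assoc, Category.assoc, hlam, h, b.isPullback.w_assoc]) ≫ 𝕋.T.map b.add

/-- The square with top `μ : E₂ ⟶ T(E)`, left side `π₀q : E₂ ⟶ M`, right side `T(q)` and
bottom `0 : M ⟶ T(M)` is a pullback preserved by each `Tⁿ` (`n = 0` being the square itself). -/
def TangentBundleFunctor.IsUniversalLift (𝕋 : TangentBundleFunctor C) {E M : C} {q : E ⟶ M}
    (b : BundleData q) (hq : AdmitsPullbackPowers 𝕋.T q) (lam : E ⟶ 𝕋.T.obj E)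
    (hlam : lam ≫ 𝕋.T.map q = q ≫ 𝕋.zero M) : Prop :=
  ∀ n : ℕ, IsPullback ((iter 𝕋.T n).map (𝕋.mu b hq lam hlam)) ((iter 𝕋.T n).map (b.π₀ ≫ q))
    ((iter 𝕋.T n).map (𝕋.T.map q)) ((iter 𝕋.T n).map (𝕋.zero M))

theorem TangentBundleFunctor.IsUniversalLift.isPullback {𝕋 : TangentBundleFunctor C} {E M : C}
    {q : E ⟶ M} {b : BundleData q} {hq : AdmitsPullbackPowers 𝕋.T q} {lam : E ⟶ 𝕋.T.obj E}
    {hlam : lam ≫ 𝕋.T.map q = q ≫ 𝕋.zero M} (h : 𝕋.IsUniversalLift b hq lam hlam) :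
    IsPullback (𝕋.mu b hq lam hlam) (b.π₀ ≫ q) (𝕋.T.map q) (𝕋.zero M) :=
  h 0

variable (C) in
/-- A tangent structure on a category. -/
structure TangentStructure extends TangentBundleFunctor C where
  /-- the vertical lift -/
  lift : T ⟶ T ⋙ T
  lift_additive : ∀ M : C, IsAdditiveMorphism (bundle M) (toTangentBundleFunctor.mapBundle M)
    (lift.app M) (toTangentBundleFunctor.zero M)
  /-- the canonical flip -/
  flip : T ⋙ T ⟶ T ⋙ T
  flip_additive : ∀ M : C, IsAdditiveMorphism (toTangentBundleFunctor.mapBundle M)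
    (bundle (T.obj M)) (flip.app M) (𝟙 (T.obj M))
  flip_flip : ∀ M : C, flip.app M ≫ flip.app M = 𝟙 (T.obj (T.obj M))
  lift_flip : ∀ M : C, lift.app M ≫ flip.app M = lift.app M
  lift_lift : ∀ M : C, lift.app M ≫ T.map (lift.app M) = lift.app M ≫ lift.app (T.obj M)
  flip_flip_flip : ∀ M : C,
    T.map (flip.app M) ≫ flip.app (T.obj M) ≫ T.map (flip.app M) =
      flip.app (T.obj M) ≫ T.map (flip.app M) ≫ flip.app (T.obj M)
  flip_map_lift : ∀ M : C,
    flip.app M ≫ T.map (lift.app M) =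
      lift.app (T.obj M) ≫ T.map (flip.app M) ≫ flip.app (T.obj M)
  lift_universal : ∀ M : C, toTangentBundleFunctor.IsUniversalLift (bundle M)
    (isAdditive M).powers (lift.app M) (lift_additive M).comm

/-- `(q, σ, ζ, λ)` is a differential bundle. -/
structure IsDifferentialBundle (𝕋 : TangentStructure C) {E M : C} {q : E ⟶ M}
    (b : BundleData q) (lam : E ⟶ 𝕋.T.obj E) : Prop where
  isAdditive : b.IsAdditiveBundle 𝕋.T
  lift_additive_map : IsAdditiveMorphism b (b.map isAdditive.powers) lam (𝕋.zero M)
  lift_additive_tangent : IsAdditiveMorphism b (𝕋.bundle E) lam b.zero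
  lift_universal : 𝕋.IsUniversalLift b isAdditive.powers lam lift_additive_map.comm
  lift_lift : lam ≫ 𝕋.lift.app E = lam ≫ 𝕋.T.map lam

/-- The map `μ := ⟨π₀λ, π₁0⟩T(σ)` of a differential bundle. -/
def IsDifferentialBundle.mu {𝕋 : TangentStructure C} {E M : C} {q : E ⟶ M}
    {b : BundleData q} {lam : E ⟶ 𝕋.T.obj E} (h : IsDifferentialBundle 𝕋 b lam) :
    b.obj₂ ⟶ 𝕋.T.obj E :=
  𝕋.toTangentBundleFunctor.mu b h.isAdditive.powers lam h.lift_additive_map.comm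

/-- For `f : X ⟶ T(E)` with `fT(q) = fpq0`, the map `{f} : X ⟶ E`, which is the first component
of the factorization of `f` through `μ`; it is the unique map with
`f = ⟨{f}λ, fp0⟩T(σ)`. -/
def IsDifferentialBundle.bracket {𝕋 : TangentStructure C} {E M : C} {q : E ⟶ M}
    {b : BundleData q} {lam : E ⟶ 𝕋.T.obj E} (h : IsDifferentialBundle 𝕋 b lam)
    {X : C} (f : X ⟶ 𝕋.T.obj E)
    (hf : f ≫ 𝕋.T.map q = (f ≫ 𝕋.p.app E ≫ q) ≫ 𝕋.zero M) : X ⟶ E :=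
  h.lift_universal.isPullback.lift f (f ≫ 𝕋.p.app E ≫ q) hf ≫ b.π₀

end TangentCategories

/-! ### Coherent differential structure on a Cartesian tangent category -/

section Coherent

variable {C : Type u} [Category.{v} C] [CartesianMonoidalCategory C]

/-- Bundle data over the final object given by `σ : A × A ⟶ A` and `ζ : 1 ⟶ A`; here `E₂` is
the product `A × A`. -/
def bundleOverUnit {A : C} (ζ : 𝟙_ C ⟶ A) (σ : A ⊗ A ⟶ A) : BundleData (toUnit A) where
  obj₂ := A ⊗ A
  π₀ := fst A A
  π₁ := snd A A
  isPullback := ⟨⟨toUnit_unique _ _⟩, ⟨PullbackCone.IsLimit.mk _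
    (fun s => CartesianMonoidalCategory.lift s.fst s.snd)
    (fun s => lift_fst _ _) (fun s => lift_snd _ _)
    (fun s m h₁ h₂ => CartesianMonoidalCategory.hom_ext _ _
      (by rw [h₁, lift_fst]) (by rw [h₂, lift_snd]))⟩⟩
  add := σ
  zero := ζ

/-- The exchange map `ex : (A × B) × (A' × B') ⟶ (A × A') × (B × B')`. -/
def ex (A B A' B' : C) : (A ⊗ B) ⊗ (A' ⊗ B') ⟶ (A ⊗ A') ⊗ (B ⊗ B') :=
  CartesianMonoidalCategory.lift (fst A B ⊗ₘ fst A' B') (snd A B ⊗ₘ snd A' B')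

/-- A coherent differential structure on a Cartesian tangent category: a choice of differential
bundle over `1` on each object, compatible with products and with `T`. Here
`inv (terminalComparison T) : 1 ⟶ T(1)` and
`inv (prodComparison T A B) : T(A) × T(B) ⟶ T(A × B)` are the inverses of the canonical maps. -/
structure CoherentDifferentialStructure (𝕋 : TangentStructure C)
    [PreservesFiniteProducts 𝕋.T] where
  ζ : ∀ A : C, 𝟙_ C ⟶ A
  σ : ∀ A : C, A ⊗ A ⟶ A
  lam : ∀ A : C, A ⟶ 𝕋.T.obj A
  isDifferentialBundle : ∀ A : C, IsDifferentialBundle 𝕋 (bundleOverUnit (ζ A) (σ A)) (lam A)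
  ζ_prod : ∀ A B : C, ζ (A ⊗ B) = CartesianMonoidalCategory.lift (ζ A) (ζ B)
  σ_prod : ∀ A B : C, σ (A ⊗ B) = ex A B A B ≫ (σ A ⊗ₘ σ B)
  lam_prod : ∀ A B : C, lam (A ⊗ B) = (lam A ⊗ₘ lam B) ≫ inv (CartesianMonoidalCategory.prodComparison 𝕋.T A B)
  ζ_tangent : ∀ A : C, ζ (𝕋.T.obj A) = inv (CartesianMonoidalCategory.terminalComparison 𝕋.T) ≫ 𝕋.T.map (ζ A)
  σ_tangent : ∀ A : C, σ (𝕋.T.obj A) = inv (CartesianMonoidalCategory.prodComparison 𝕋.T A A) ≫ 𝕋.T.map (σ A)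
  lam_tangent : ∀ A : C, lam (𝕋.T.obj A) = 𝕋.T.map (lam A) ≫ 𝕋.flip.app A

variable {𝕋 : TangentStructure C} [PreservesFiniteProducts 𝕋.T]

/-- `μ_A : A × A ⟶ T(A)`. -/
def CoherentDifferentialStructure.mu (S : CoherentDifferentialStructure 𝕋) (A : C) :
    A ⊗ A ⟶ 𝕋.T.obj A :=
  (S.isDifferentialBundle A).mu

/-- `p̂_A := {1_{T(A)}} : T(A) ⟶ A`. -/
def CoherentDifferentialStructure.pHat (S : CoherentDifferentialStructure 𝕋) (A : C) :
    𝕋.T.obj A ⟶ A :=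
  (S.isDifferentialBundle A).bracket (𝟙 (𝕋.T.obj A)) (by
    have : IsIso (CartesianMonoidalCategory.terminalComparison 𝕋.T) := inferInstance
    rw [← cancel_mono (CartesianMonoidalCategory.terminalComparison 𝕋.T)]
    exact toUnit_unique _ _)

end Coherent

/-! ### Cartesian differential categories -/

section CDC

/-- A Cartesian left additive category: each hom-set is a commutative monoid, composition with a
fixed map on the left is additive, and the projections are additive maps. -/
class CartesianLeftAdditive (C : Type u) [Category.{v} C] [CartesianMonoidalCategory C] where
  homAddCommMonoid : ∀ X Y : C, AddCommMonoid (X ⟶ Y)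
  comp_add : ∀ {X Y Z : C} (f : X ⟶ Y) (h k : Y ⟶ Z), f ≫ (h + k) = f ≫ h + f ≫ k
  comp_zero : ∀ {X Y Z : C} (f : X ⟶ Y), f ≫ (0 : Y ⟶ Z) = 0
  add_fst : ∀ {X A B : C} (f g : X ⟶ A ⊗ B), (f + g) ≫ fst A B = f ≫ fst A B + g ≫ fst A B
  zero_fst : ∀ X A B : C, (0 : X ⟶ A ⊗ B) ≫ fst A B = 0
  add_snd : ∀ {X A B : C} (f g : X ⟶ A ⊗ B), (f + g) ≫ snd A B = f ≫ snd A B + g ≫ snd A B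
  zero_snd : ∀ X A B : C, (0 : X ⟶ A ⊗ B) ≫ snd A B = 0

attribute [reducible, instance] CartesianLeftAdditive.homAddCommMonoid

/-- A Cartesian differential category: a Cartesian left additive category with a differential
combinator `D`. -/
class CartesianDifferential (C : Type u) [Category.{v} C] [CartesianMonoidalCategory C]
    extends CartesianLeftAdditive C where
  D : ∀ {A B : C}, (A ⟶ B) → (A ⊗ A ⟶ B)
  cd1_add : ∀ {A B : C} (f g : A ⟶ B), D (f + g) = D f + D g
  cd1_zero : ∀ A B : C, D (0 : A ⟶ B) = 0
  cd2_add : ∀ {X A B : C} (a b c : X ⟶ A) (f : A ⟶ B),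
    CartesianMonoidalCategory.lift (a + b) c ≫ D f =
      CartesianMonoidalCategory.lift a c ≫ D f + CartesianMonoidalCategory.lift b c ≫ D f
  cd2_zero : ∀ {X A B : C} (a : X ⟶ A) (f : A ⟶ B),
    CartesianMonoidalCategory.lift (0 : X ⟶ A) a ≫ D f = 0
  cd3_fst : ∀ A B : C, D (fst A B) = fst (A ⊗ B) (A ⊗ B) ≫ fst A B
  cd3_snd : ∀ A B : C, D (snd A B) = fst (A ⊗ B) (A ⊗ B) ≫ snd A B
  cd4 : ∀ {X A B : C} (f : X ⟶ A) (g : X ⟶ B),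
    D (CartesianMonoidalCategory.lift f g) = CartesianMonoidalCategory.lift (D f) (D g)
  cd5 : ∀ {A B E : C} (f : A ⟶ B) (g : B ⟶ E),
    D (f ≫ g) = CartesianMonoidalCategory.lift (D f) (snd A A ≫ f) ≫ D g
  cd6 : ∀ {X A B : C} (a d : X ⟶ A) (f : A ⟶ B),
    CartesianMonoidalCategory.lift (CartesianMonoidalCategory.lift a 0)
      (CartesianMonoidalCategory.lift 0 d) ≫ D (D f) = CartesianMonoidalCategory.lift a d ≫ D f
  cd7 : ∀ {X A B : C} (a b c d : X ⟶ A) (f : A ⟶ B),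
    CartesianMonoidalCategory.lift (CartesianMonoidalCategory.lift a b)
      (CartesianMonoidalCategory.lift c d) ≫ D (D f) =
    CartesianMonoidalCategory.lift (CartesianMonoidalCategory.lift a c)
      (CartesianMonoidalCategory.lift b d) ≫ D (D f)

end CDC

end

end Tangent

/-! Over the final object the universality square makes `μ` an isomorphism `A × A ≅ T(A)` with
inverse `⟨p̂, p⟩`. So a tangent vector `u` is determined by a vertical part and a base point: `u =
(u p̂)λ + (u p)0` (`comp_pHat_lam_add`). A value of `p̂` can then be read off from any such
expression (`comp_pHat_eq`), and `D[f]` is the vertical part of `T(f)`.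

By [CDS.2] the addition of `T(A)` is `T(σ)`, so `T` preserves sums of maps, and naturality makes
`p`, `0`, `ℓ`, `c` additive; with additivity of `p̂` this gives [CD.1]. For a general `f`, `T(f)`
preserves only the fibrewise sums of tangent vectors. [CD.2] therefore rests on `tangentSum_mu` and
`tangentSum_comp_pHat`, which identify fibrewise sums with sums of vertical parts. Linear maps, the
additive maps compatible with `λ`, commute with `p̂`; the projections are linear by [CDS.1], whence
[CD.3] and [CD.4]. The chain rule is functoriality of `T` read through `μ`.

For second derivatives, `μT(μ)` puts four coordinates on `T(T(A))`. In these, `ℓ` fills two opposite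
corners and `c` exchanges the middle two. The identities `ℓT(p̂)p̂ = p̂` and `cT(p̂)p̂ = T(p̂)p̂`,
together with naturality of `ℓ` and `c`, give [CD.6] and [CD.7]. -/

namespace Tangent

variable {C : Type u} [Category.{v} C]

/-! ### Fibrewise sums in the tangent bundle and their naturality. -/

namespace TangentBundleFunctor

variable (𝕋 : TangentBundleFunctor C)

/-- The projection `p_M : T(M) ⟶ M`. -/
def proj (M : C) : 𝕋.T.obj M ⟶ M :=
  𝕋.p.app M

theorem zero_comp_map {M N : C} (f : M ⟶ N) :
    𝕋.zero M ≫ 𝕋.T.map f = f ≫ 𝕋.zero N :=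
  (𝕋.zero_naturality f).symm

theorem zero_comp_proj (M : C) : 𝕋.zero M ≫ 𝕋.proj M = 𝟙 M :=
  (𝕋.isAdditive M).isCommMonoid.zero_comp

theorem proj_naturality {M N : C} (f : M ⟶ N) : 𝕋.T.map f ≫ 𝕋.proj N = 𝕋.proj M ≫ f :=
  𝕋.p.naturality f

/-- The pair of two tangent vectors in one fibre. -/
noncomputable def tangentPair {X M : C} (u w : X ⟶ 𝕋.T.obj M)
    (h : u ≫ 𝕋.proj M = w ≫ 𝕋.proj M) : X ⟶ (𝕋.bundle M).obj₂ :=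
  (𝕋.bundle M).isPullback.lift u w h

@[simp]
theorem tangentPair_π₀ {X M : C} (u w : X ⟶ 𝕋.T.obj M) (h : u ≫ 𝕋.proj M = w ≫ 𝕋.proj M) :
    𝕋.tangentPair u w h ≫ (𝕋.bundle M).π₀ = u :=
  (𝕋.bundle M).isPullback.lift_fst _ _ _

@[simp]
theorem tangentPair_π₁ {X M : C} (u w : X ⟶ 𝕋.T.obj M) (h : u ≫ 𝕋.proj M = w ≫ 𝕋.proj M) :
    𝕋.tangentPair u w h ≫ (𝕋.bundle M).π₁ = w :=
  (𝕋.bundle M).isPullback.lift_snd _ _ _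

theorem eq_tangentPair {X M : C} {t : X ⟶ (𝕋.bundle M).obj₂} {u w : X ⟶ 𝕋.T.obj M}
    (h : u ≫ 𝕋.proj M = w ≫ 𝕋.proj M) (h₀ : t ≫ (𝕋.bundle M).π₀ = u)
    (h₁ : t ≫ (𝕋.bundle M).π₁ = w) : t = 𝕋.tangentPair u w h :=
  (𝕋.bundle M).isPullback.hom_ext (h₀.trans (𝕋.tangentPair_π₀ u w h).symm)
    (h₁.trans (𝕋.tangentPair_π₁ u w h).symm)

theorem comp_tangentPair {X Y M : C} (t : Y ⟶ X) (u w : X ⟶ 𝕋.T.obj M)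
    (h : u ≫ 𝕋.proj M = w ≫ 𝕋.proj M) (h' : (t ≫ u) ≫ 𝕋.proj M = (t ≫ w) ≫ 𝕋.proj M) :
    t ≫ 𝕋.tangentPair u w h = 𝕋.tangentPair (t ≫ u) (t ≫ w) h' :=
  𝕋.eq_tangentPair h' (by simp) (by simp)

/-- The sum of two tangent vectors in one fibre. -/
noncomputable def tangentSum {X M : C} (u w : X ⟶ 𝕋.T.obj M)
    (h : u ≫ 𝕋.proj M = w ≫ 𝕋.proj M) : X ⟶ 𝕋.T.obj M :=
  𝕋.tangentPair u w h ≫ (𝕋.bundle M).add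

theorem comp_tangentSum {X Y M : C} (t : Y ⟶ X) (u w : X ⟶ 𝕋.T.obj M)
    (h : u ≫ 𝕋.proj M = w ≫ 𝕋.proj M) (h' : (t ≫ u) ≫ 𝕋.proj M = (t ≫ w) ≫ 𝕋.proj M) :
    t ≫ 𝕋.tangentSum u w h = 𝕋.tangentSum (t ≫ u) (t ≫ w) h' := by
  rw [tangentSum, tangentSum, ← Category.assoc, comp_tangentPair]

theorem comp_map_proj_eq {X M N : C} (f : M ⟶ N) {u w : X ⟶ 𝕋.T.obj M}
    (h : u ≫ 𝕋.proj M = w ≫ 𝕋.proj M) :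
    (u ≫ 𝕋.T.map f) ≫ 𝕋.proj N = (w ≫ 𝕋.T.map f) ≫ 𝕋.proj N := by
  rw [Category.assoc, Category.assoc, proj_naturality, ← Category.assoc, ← Category.assoc, h]

/-- The maps `T(f)` preserve sums of tangent vectors in one fibre. -/
theorem tangentSum_comp_map {X M N : C} (f : M ⟶ N) (u w : X ⟶ 𝕋.T.obj M)
    (h : u ≫ 𝕋.proj M = w ≫ 𝕋.proj M) :
    𝕋.tangentSum u w h ≫ 𝕋.T.map f =
      𝕋.tangentSum (u ≫ 𝕋.T.map f) (w ≫ 𝕋.T.map f) (𝕋.comp_map_proj_eq f h) := by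
  have hπ : ((𝕋.bundle M).π₀ ≫ 𝕋.T.map f) ≫ 𝕋.proj N =
      ((𝕋.bundle M).π₁ ≫ 𝕋.T.map f) ≫ 𝕋.proj N :=
    𝕋.comp_map_proj_eq f (𝕋.bundle M).isPullback.w
  have e : 𝕋.tangentPair ((𝕋.bundle M).π₀ ≫ 𝕋.T.map f) ((𝕋.bundle M).π₁ ≫ 𝕋.T.map f) hπ ≫
      (𝕋.bundle N).add = (𝕋.bundle M).add ≫ 𝕋.T.map f :=
    𝕋.add_naturality f
  rw [tangentSum, tangentSum, Category.assoc, ← e, ← Category.assoc]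
  congr 1
  apply eq_tangentPair
  · rw [Category.assoc, tangentPair_π₀, ← Category.assoc, tangentPair_π₀]
  · rw [Category.assoc, tangentPair_π₁, ← Category.assoc, tangentPair_π₁]

/-- The zero tangent vector at a point is idempotent for fibrewise addition. -/
theorem tangentSum_zero_zero {X M : C} (x : X ⟶ M) :
    𝕋.tangentSum (x ≫ 𝕋.zero M) (x ≫ 𝕋.zero M) rfl = x ≫ 𝕋.zero M := by
  have h := (𝕋.isAdditive M).isCommMonoid.zero_add (x ≫ 𝕋.zero M)
  have e : (x ≫ 𝕋.zero M) ≫ 𝕋.p.app M ≫ (𝕋.bundle M).zero = x ≫ 𝕋.zero M := by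
    have e' : (x ≫ 𝕋.zero M) ≫ 𝕋.proj M ≫ 𝕋.zero M = x ≫ 𝕋.zero M := by
      rw [Category.assoc, ← Category.assoc (𝕋.zero M), zero_comp_proj, Category.id_comp]
    exact e'
  simp only [e] at h
  exact h

end TangentBundleFunctor

/-! ### The vertical lift and the canonical flip. -/

namespace TangentStructure

variable (𝕋 : TangentStructure C)

/-- The vertical lift `ℓ_M : T(M) ⟶ T(T(M))`. -/
def vlift (M : C) : 𝕋.T.obj M ⟶ 𝕋.T.obj (𝕋.T.obj M) :=
  𝕋.lift.app M

/-- The canonical flip `c_M : T(T(M)) ⟶ T(T(M))`. -/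
def cflip (M : C) : 𝕋.T.obj (𝕋.T.obj M) ⟶ 𝕋.T.obj (𝕋.T.obj M) :=
  𝕋.flip.app M

theorem zero_vlift (M : C) : 𝕋.zero M ≫ 𝕋.vlift M = 𝕋.zero M ≫ 𝕋.T.map (𝕋.zero M) :=
  (𝕋.lift_additive M).map_zero.symm

theorem map_zero_cflip (M : C) : 𝕋.T.map (𝕋.zero M) ≫ 𝕋.cflip M = 𝕋.zero (𝕋.T.obj M) :=
  (𝕋.flip_additive M).map_zero.symm.trans (Category.id_comp _)

theorem cflip_cflip (M : C) : 𝕋.cflip M ≫ 𝕋.cflip M = 𝟙 _ :=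
  𝕋.flip_flip M

theorem vlift_cflip (M : C) : 𝕋.vlift M ≫ 𝕋.cflip M = 𝕋.vlift M :=
  𝕋.lift_flip M

theorem zero_cflip (M : C) : 𝕋.zero (𝕋.T.obj M) ≫ 𝕋.cflip M = 𝕋.T.map (𝕋.zero M) := by
  rw [← map_zero_cflip, Category.assoc, cflip_cflip, Category.comp_id]

theorem vlift_naturality {M N : C} (f : M ⟶ N) :
    𝕋.T.map f ≫ 𝕋.vlift N = 𝕋.vlift M ≫ 𝕋.T.map (𝕋.T.map f) :=
  𝕋.lift.naturality f

theorem cflip_naturality {M N : C} (f : M ⟶ N) :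
    𝕋.T.map (𝕋.T.map f) ≫ 𝕋.cflip N = 𝕋.cflip M ≫ 𝕋.T.map (𝕋.T.map f) :=
  𝕋.flip.naturality f

end TangentStructure

variable [CartesianMonoidalCategory C]

theorem bundleOverUnit_lift {A : C} (ζ : 𝟙_ C ⟶ A) (σ : A ⊗ A ⟶ A) {X : C} (x y : X ⟶ A)
    (h : x ≫ toUnit A = y ≫ toUnit A) :
    (bundleOverUnit ζ σ).isPullback.lift x y h = CartesianMonoidalCategory.lift x y :=
  CartesianMonoidalCategory.hom_ext _ _
    (((bundleOverUnit ζ σ).isPullback.lift_fst x y h).trans (lift_fst _ _).symm)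
    (((bundleOverUnit ζ σ).isPullback.lift_snd x y h).trans (lift_snd _ _).symm)

/-! ### The commutative monoids of maps. -/

namespace CoherentDifferentialStructure

variable {𝕋 : TangentStructure C} [PreservesFiniteProducts 𝕋.T]
  (S : CoherentDifferentialStructure 𝕋)

/-- The sum `⟨f, g⟩σ` of parallel maps. -/
def add {X A : C} (f g : X ⟶ A) : X ⟶ A :=
  CartesianMonoidalCategory.lift f g ≫ S.σ A

/-- The zero map `!ζ`. -/
def zero (X A : C) : X ⟶ A :=
  toUnit X ≫ S.ζ A

/-- Any two maps into `A` lie in one fibre over `1`, so the monoid laws of the bundle become laws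
for all parallel maps. -/
theorem sum_eq_add {X A : C} (f g : X ⟶ A) (h : f ≫ toUnit A = g ≫ toUnit A) :
    (bundleOverUnit (S.ζ A) (S.σ A)).sum f g h = S.add f g := by
  rw [BundleData.sum, bundleOverUnit_lift]; rfl

theorem isCommMonoid (A : C) : (bundleOverUnit (S.ζ A) (S.σ A)).IsCommMonoid :=
  (S.isDifferentialBundle A).isAdditive.isCommMonoid

theorem comp_add {X Y A : C} (f : X ⟶ Y) (g h : Y ⟶ A) :
    f ≫ S.add g h = S.add (f ≫ g) (f ≫ h) := by
  simp only [add, comp_lift_assoc]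

theorem comp_zero {X Y : C} (f : X ⟶ Y) (A : C) : f ≫ S.zero Y A = S.zero X A := by
  simp only [zero, comp_toUnit_assoc]

theorem add_comm {X A : C} (f g : X ⟶ A) : S.add f g = S.add g f := by
  have h := (S.isCommMonoid A).add_comm f g (toUnit_unique _ _)
  simpa only [sum_eq_add] using h

theorem add_assoc {X A : C} (f g h : X ⟶ A) : S.add (S.add f g) h = S.add f (S.add g h) := by
  have h := (S.isCommMonoid A).add_assoc f g h (toUnit_unique _ _) (toUnit_unique _ _)
  simpa only [sum_eq_add] using h

theorem zero_add {X A : C} (f : X ⟶ A) : S.add (S.zero X A) f = f := by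
  have h := (S.isCommMonoid A).zero_add f
  have e : f ≫ toUnit A ≫ (bundleOverUnit (S.ζ A) (S.σ A)).zero = S.zero X A :=
    S.comp_zero f A
  simpa only [sum_eq_add, e] using h

theorem add_zero {X A : C} (f : X ⟶ A) : S.add f (S.zero X A) = f := by
  rw [add_comm, zero_add]

theorem add_add_add_comm {X A : C} (a b c d : X ⟶ A) :
    S.add (S.add a b) (S.add c d) = S.add (S.add a c) (S.add b d) := by
  rw [add_assoc, add_assoc, ← S.add_assoc b, S.add_comm b c, S.add_assoc c]

theorem σ_eq_add (A : C) : S.σ A = S.add (fst A A) (snd A A) := by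
  simp [add]

/-- The commutative monoid of maps `X ⟶ A`. -/
abbrev homAddCommMonoid (X A : C) : AddCommMonoid (X ⟶ A) where
  add := S.add
  zero := S.zero X A
  nsmul := letI : Zero (X ⟶ A) := ⟨S.zero X A⟩
    letI : Add (X ⟶ A) := ⟨S.add⟩
    nsmulRec
  add_assoc := S.add_assoc
  zero_add := S.zero_add
  add_zero := S.add_zero
  add_comm := S.add_comm

/-! ### Additive maps -/

/-- Maps that preserve the sum and the zero of their source and target. -/
structure IsAdditive {A B : C} (h : A ⟶ B) : Prop where
  σ_comp : S.σ A ≫ h = S.add (fst A A ≫ h) (snd A A ≫ h)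
  ζ_comp : S.ζ A ≫ h = S.ζ B

variable {S}

theorem IsAdditive.add_comp {A B : C} {h : A ⟶ B} (hh : S.IsAdditive h) {X : C} (f g : X ⟶ A) :
    S.add f g ≫ h = S.add (f ≫ h) (g ≫ h) := by
  rw [add, Category.assoc, hh.σ_comp, comp_add, lift_fst_assoc, lift_snd_assoc]

theorem IsAdditive.zero_comp {A B : C} {h : A ⟶ B} (hh : S.IsAdditive h) (X : C) :
    S.zero X A ≫ h = S.zero X B := by
  rw [zero, Category.assoc, hh.ζ_comp]; rfl

variable (S)

theorem isAdditive_fst (A B : C) : S.IsAdditive (fst A B) where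
  σ_comp := by
    rw [S.σ_prod, ex, add, Category.assoc, tensorHom_fst, lift_fst_assoc]
    congr 1
    ext <;> simp
  ζ_comp := by rw [S.ζ_prod, lift_fst]

theorem isAdditive_snd (A B : C) : S.IsAdditive (snd A B) where
  σ_comp := by
    rw [S.σ_prod, ex, add, Category.assoc, tensorHom_snd, lift_snd_assoc]
    congr 1
    ext <;> simp
  ζ_comp := by rw [S.ζ_prod, lift_snd]

/-- The functor `T` preserves sums of maps. -/
theorem map_add {A B : C} (f g : A ⟶ B) :
    𝕋.T.map (S.add f g) = S.add (𝕋.T.map f) (𝕋.T.map g) := by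
  rw [add, add, Functor.map_comp, S.σ_tangent, ← Category.assoc]
  congr 1
  -- By [CDS.2] what remains is that `T⟨f, g⟩` corresponds to `⟨T(f), T(g)⟩` under the product
  -- comparison.
  rw [IsIso.eq_comp_inv]
  ext <;> simp [← Functor.map_comp]

theorem map_ζ_eq {X : C} (w : X ⟶ 𝕋.T.obj (𝟙_ C)) (A : C) :
    w ≫ 𝕋.T.map (S.ζ A) = S.zero X (𝕋.T.obj A) := by
  rw [zero, S.ζ_tangent, ← Category.assoc]
  congr 1
  rw [IsIso.eq_comp_inv]
  exact toUnit_unique _ _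

/-- The functor `T` preserves zero maps. -/
theorem map_zero (A B : C) : 𝕋.T.map (S.zero A B) = S.zero (𝕋.T.obj A) (𝕋.T.obj B) := by
  rw [zero, Functor.map_comp, map_ζ_eq]

variable (𝕋) in
-- Since `T` preserves products, a pair of maps into `T(A)` and `T(A)` comes from one map into `T(A
-- × A)`. Naturality with respect to `σ` then yields additivity statements.
theorem exists_map_fst_snd {X A B : C} (u : X ⟶ 𝕋.T.obj A) (w : X ⟶ 𝕋.T.obj B) :
    ∃ z : X ⟶ 𝕋.T.obj (A ⊗ B), z ≫ 𝕋.T.map (fst A B) = u ∧ z ≫ 𝕋.T.map (snd A B) = w :=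
  ⟨CartesianMonoidalCategory.lift u w ≫ inv (CartesianMonoidalCategory.prodComparison 𝕋.T A B),
    by simp, by simp⟩

variable (𝕋) in
theorem exists_map_map_fst_snd {X A B : C} (u : X ⟶ 𝕋.T.obj (𝕋.T.obj A))
    (w : X ⟶ 𝕋.T.obj (𝕋.T.obj B)) :
    ∃ z : X ⟶ 𝕋.T.obj (𝕋.T.obj (A ⊗ B)),
      z ≫ 𝕋.T.map (𝕋.T.map (fst A B)) = u ∧ z ≫ 𝕋.T.map (𝕋.T.map (snd A B)) = w := by
  obtain ⟨z, rfl, rfl⟩ := exists_map_fst_snd 𝕋 u w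
  refine ⟨z ≫ 𝕋.T.map (inv (CartesianMonoidalCategory.prodComparison 𝕋.T A B)), ?_, ?_⟩
  · rw [Category.assoc, ← Functor.map_comp, CartesianMonoidalCategory.inv_prodComparison_map_fst]
  · rw [Category.assoc, ← Functor.map_comp, CartesianMonoidalCategory.inv_prodComparison_map_snd]

/-- Sums of maps into `T(A)` are computed by `T(σ)`. -/
theorem comp_map_σ {X A : C} (z : X ⟶ 𝕋.T.obj (A ⊗ A)) :
    z ≫ 𝕋.T.map (S.σ A) = S.add (z ≫ 𝕋.T.map (fst A A)) (z ≫ 𝕋.T.map (snd A A)) := by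
  rw [σ_eq_add, map_add, comp_add]

theorem comp_map_map_σ {X A : C} (z : X ⟶ 𝕋.T.obj (𝕋.T.obj (A ⊗ A))) :
    z ≫ 𝕋.T.map (𝕋.T.map (S.σ A)) =
      S.add (z ≫ 𝕋.T.map (𝕋.T.map (fst A A))) (z ≫ 𝕋.T.map (𝕋.T.map (snd A A))) := by
  rw [σ_eq_add, map_add, map_add, comp_add]

variable {S}

theorem IsAdditive.map {A B : C} {h : A ⟶ B} (hh : S.IsAdditive h) :
    S.IsAdditive (𝕋.T.map h) where
  σ_comp := by
    obtain ⟨z, h₁, h₂⟩ := exists_map_fst_snd 𝕋 (fst (𝕋.T.obj A) (𝕋.T.obj A)) (snd _ _)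
    rw [σ_eq_add, ← h₁, ← h₂, ← comp_map_σ, Category.assoc, ← Functor.map_comp, hh.σ_comp,
      map_add, comp_add]
    simp only [Functor.map_comp, Category.assoc]
  ζ_comp := by
    rw [S.ζ_tangent, Category.assoc, ← Functor.map_comp, hh.ζ_comp, ← S.ζ_tangent]

variable (S)

theorem isAdditive_proj (A : C) : S.IsAdditive (𝕋.proj A) where
  σ_comp := by
    obtain ⟨z, h₁, h₂⟩ := exists_map_fst_snd 𝕋 (fst (𝕋.T.obj A) (𝕋.T.obj A)) (snd _ _)
    rw [σ_eq_add, ← h₁, ← h₂, ← comp_map_σ, Category.assoc, 𝕋.proj_naturality, σ_eq_add, comp_add,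
      comp_add]
    simp only [Category.assoc, 𝕋.proj_naturality]
  ζ_comp := by
    rw [S.ζ_tangent, Category.assoc, 𝕋.proj_naturality, ← Category.assoc]
    -- The factor before `ζ` is an endomorphism of the final object, hence the identity.
    exact (congrArg (· ≫ S.ζ A) (toUnit_unique _ (𝟙 _))).trans (Category.id_comp _)

theorem isAdditive_tangentZero (A : C) : S.IsAdditive (𝕋.zero A) where
  σ_comp := by
    rw [← 𝕋.zero_comp_map, comp_map_σ, 𝕋.zero_comp_map, 𝕋.zero_comp_map]
  ζ_comp := by
    rw [← 𝕋.zero_comp_map, map_ζ_eq, zero]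
    exact (congrArg (· ≫ S.ζ _) (toUnit_unique _ (𝟙 _))).trans (Category.id_comp _)

/-- Sums in `T(A)` and `T(T(A))` are given by `T(σ)` and `T(T(σ))`, and `ℓ` is natural at `σ`; the
flip is treated likewise. -/
theorem add_comp_vlift {X A : C} (u w : X ⟶ 𝕋.T.obj A) :
    S.add u w ≫ 𝕋.vlift A = S.add (u ≫ 𝕋.vlift A) (w ≫ 𝕋.vlift A) := by
  obtain ⟨z, rfl, rfl⟩ := exists_map_fst_snd 𝕋 u w
  rw [← comp_map_σ, Category.assoc, 𝕋.vlift_naturality, ← Category.assoc]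
  rw [comp_map_map_σ]
  simp only [Category.assoc, 𝕋.vlift_naturality]

theorem add_comp_cflip {X A : C} (u w : X ⟶ 𝕋.T.obj (𝕋.T.obj A)) :
    S.add u w ≫ 𝕋.cflip A = S.add (u ≫ 𝕋.cflip A) (w ≫ 𝕋.cflip A) := by
  obtain ⟨z, rfl, rfl⟩ := exists_map_map_fst_snd 𝕋 u w
  rw [← comp_map_map_σ, Category.assoc, 𝕋.cflip_naturality, ← Category.assoc]
  refine (S.comp_map_map_σ _).trans ?_
  simp only [Category.assoc, 𝕋.cflip_naturality]

/-- Translates the pullback formulation of the bundle axioms, and of `μ`, into sums of maps by means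
of [CDS.2]. -/
theorem map_bundle_lift_comp {X A : C} (u w : X ⟶ 𝕋.T.obj A)
    (hq : AdmitsPullbackPowers 𝕋.T (toUnit A))
    (h : u ≫ 𝕋.T.map (toUnit A) = w ≫ 𝕋.T.map (toUnit A)) :
    ((bundleOverUnit (S.ζ A) (S.σ A)).map hq).isPullback.lift u w h ≫ 𝕋.T.map (S.σ A) =
      S.add u w := by
  refine (S.comp_map_σ _).trans ?_
  congr 1
  · exact ((bundleOverUnit (S.ζ A) (S.σ A)).map hq).isPullback.lift_fst u w h
  · exact ((bundleOverUnit (S.ζ A) (S.σ A)).map hq).isPullback.lift_snd u w h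

theorem isAdditive_lam (A : C) : S.IsAdditive (S.lam A) where
  σ_comp := by
    have h := (S.isDifferentialBundle A).lift_additive_map.map_add
    exact h.symm.trans (S.map_bundle_lift_comp _ _ _ _)
  ζ_comp := by
    have h := (S.isDifferentialBundle A).lift_additive_map.map_zero
    refine h.symm.trans ?_
    refine (S.map_ζ_eq (𝕋.zero _) A).trans ?_
    exact (congrArg (· ≫ S.ζ _) (toUnit_unique _ (𝟙 _))).trans (Category.id_comp _)

theorem lam_comp_proj (A : C) : S.lam A ≫ 𝕋.proj A = S.zero A A :=
  (S.isDifferentialBundle A).lift_additive_tangent.comm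

theorem lam_comp_vlift (A : C) : S.lam A ≫ 𝕋.vlift A = S.lam A ≫ 𝕋.T.map (S.lam A) :=
  (S.isDifferentialBundle A).lift_lift

theorem lam_fibre {X A : C} (a b : X ⟶ A) :
    (a ≫ S.lam A) ≫ 𝕋.proj A = (b ≫ S.lam A) ≫ 𝕋.proj A := by
  simp only [Category.assoc, lam_comp_proj, comp_zero]

/-- The lift turns sums into fibrewise sums of tangent vectors at zero. -/
theorem tangentSum_lam {X A : C} (a b : X ⟶ A) :
    𝕋.tangentSum (a ≫ S.lam A) (b ≫ S.lam A) (S.lam_fibre a b) =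
      S.add a b ≫ S.lam A := by
  have h : 𝕋.tangentSum (fst A A ≫ S.lam A) (snd A A ≫ S.lam A) (S.lam_fibre _ _) =
      S.σ A ≫ S.lam A :=
    (S.isDifferentialBundle A).lift_additive_tangent.map_add
  rw [add, Category.assoc, ← h, 𝕋.comp_tangentSum]
  · simp only [lift_fst_assoc, lift_snd_assoc]
  · simpa only [lift_fst_assoc, lift_snd_assoc] using S.lam_fibre a b

/-! ### The isomorphism between `A × A` and `T(A)` -/

theorem mu_eq (A : C) : S.mu A = S.add (fst A A ≫ S.lam A) (snd A A ≫ 𝕋.zero A) :=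
  S.map_bundle_lift_comp _ _ _ _

theorem comp_mu {X A : C} (a b : X ⟶ A) :
    CartesianMonoidalCategory.lift a b ≫ S.mu A = S.add (a ≫ S.lam A) (b ≫ 𝕋.zero A) := by
  rw [mu_eq, comp_add, lift_fst_assoc, lift_snd_assoc]

theorem mu_comp_proj (A : C) : S.mu A ≫ 𝕋.proj A = snd A A := by
  rw [mu_eq, (S.isAdditive_proj A).add_comp]
  simp only [Category.assoc, lam_comp_proj, comp_zero, 𝕋.zero_comp_proj, zero_add, Category.comp_id]

theorem isPullback_mu (A : C) : IsPullback (S.mu A) (fst A A ≫ toUnit A)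
    (𝕋.T.map (toUnit A)) (𝕋.zero (𝟙_ C)) :=
  (S.isDifferentialBundle A).lift_universal.isPullback

theorem mu_injective {X A : C} {x y : X ⟶ A ⊗ A} (h : x ≫ S.mu A = y ≫ S.mu A) : x = y :=
  (S.isPullback_mu A).hom_ext h (toUnit_unique _ _)

/-- The factorization of the identity through `μ` has first component `p̂` by definition, and second
component `p` because `μp = π₁`. -/
theorem lift_pHat_proj_comp_mu (A : C) :
    CartesianMonoidalCategory.lift (S.pHat A) (𝕋.proj A) ≫ S.mu A = 𝟙 (𝕋.T.obj A) := by
  obtain ⟨z, hz, hp⟩ : ∃ z : 𝕋.T.obj A ⟶ A ⊗ A, z ≫ S.mu A = 𝟙 _ ∧ S.pHat A = z ≫ fst A A :=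
    ⟨_, (S.isPullback_mu A).lift_fst _ _ _, rfl⟩
  have h : 𝕋.proj A = z ≫ snd A A := by
    rw [← mu_comp_proj S, ← Category.assoc, hz, Category.id_comp]
  rw [hp, h, ← comp_lift, CartesianMonoidalCategory.lift_fst_snd, Category.comp_id, hz]

/-- Every tangent vector is the sum of its vertical part and its base point. -/
theorem comp_pHat_lam_add {X A : C} (u : X ⟶ 𝕋.T.obj A) :
    S.add ((u ≫ S.pHat A) ≫ S.lam A) ((u ≫ 𝕋.proj A) ≫ 𝕋.zero A) = u := by
  have h := S.lift_pHat_proj_comp_mu A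
  rw [comp_mu] at h
  simpa only [comp_add, Category.assoc, Category.comp_id] using congrArg (u ≫ ·) h

theorem add_lam_zero_comp_pHat {X A : C} (a b : X ⟶ A) :
    S.add (a ≫ S.lam A) (b ≫ 𝕋.zero A) ≫ S.pHat A = a := by
  have h : S.add (a ≫ S.lam A) (b ≫ 𝕋.zero A) ≫
      CartesianMonoidalCategory.lift (S.pHat A) (𝕋.proj A) =
        CartesianMonoidalCategory.lift a b := by
    apply S.mu_injective
    rw [Category.assoc, lift_pHat_proj_comp_mu, Category.comp_id, comp_mu]
  simpa using congrArg (· ≫ fst A A) h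

theorem comp_pHat_eq {X A : C} {u : X ⟶ 𝕋.T.obj A} {a b : X ⟶ A}
    (h : u = S.add (a ≫ S.lam A) (b ≫ 𝕋.zero A)) : u ≫ S.pHat A = a := by
  rw [h, add_lam_zero_comp_pHat]

theorem mu_comp_pHat (A : C) : S.mu A ≫ S.pHat A = fst A A :=
  S.comp_pHat_eq (S.mu_eq A)

theorem lam_comp_pHat (A : C) : S.lam A ≫ S.pHat A = 𝟙 A := by
  apply S.comp_pHat_eq (b := S.zero A A)
  rw [(S.isAdditive_tangentZero A).zero_comp, add_zero, Category.id_comp]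

theorem tangentZero_comp_pHat (A : C) : 𝕋.zero A ≫ S.pHat A = S.zero A A := by
  apply S.comp_pHat_eq (b := 𝟙 A)
  rw [(S.isAdditive_lam A).zero_comp, zero_add, Category.id_comp]

/-- Adding the decompositions of the two vectors and regrouping gives a decomposition of the sum, as
`λ` and `0` are additive. -/
theorem add_comp_pHat {X A : C} (u w : X ⟶ 𝕋.T.obj A) :
    S.add u w ≫ S.pHat A = S.add (u ≫ S.pHat A) (w ≫ S.pHat A) := by
  apply S.comp_pHat_eq (b := S.add (u ≫ 𝕋.proj A) (w ≫ 𝕋.proj A))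
  rw [(S.isAdditive_lam A).add_comp, (S.isAdditive_tangentZero A).add_comp, add_add_add_comm,
    comp_pHat_lam_add, comp_pHat_lam_add]

theorem zero_comp_pHat (X A : C) : S.zero X (𝕋.T.obj A) ≫ S.pHat A = S.zero X A := by
  apply S.comp_pHat_eq (b := S.zero X A)
  rw [(S.isAdditive_lam A).zero_comp, (S.isAdditive_tangentZero A).zero_comp, zero_add]

theorem isAdditive_pHat (A : C) : S.IsAdditive (S.pHat A) where
  σ_comp := by rw [σ_eq_add, add_comp_pHat]
  ζ_comp := by
    have h := S.zero_comp_pHat (𝟙_ C) A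
    simpa [zero, toUnit_unit] using h

/-! ### Linear maps -/

/-- Additive maps that commute with the lifts. -/
structure IsLinear {A B : C} (h : A ⟶ B) : Prop extends S.IsAdditive h where
  lam_comp_map : S.lam A ≫ 𝕋.T.map h = h ≫ S.lam B

variable {S}

/-- Applying `T(h)` to the decomposition `1 = p̂λ + p0` gives `T(h) = (p̂h)λ + (ph)0`, whose
vertical part is visible. -/
theorem IsLinear.map_comp_pHat {A B : C} {h : A ⟶ B} (hh : S.IsLinear h) :
    𝕋.T.map h ≫ S.pHat B = S.pHat A ≫ h := by
  apply S.comp_pHat_eq (b := 𝕋.proj A ≫ h)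
  have e := S.comp_pHat_lam_add (𝟙 (𝕋.T.obj A))
  simp only [Category.id_comp] at e
  have e' := congrArg (· ≫ 𝕋.T.map h) e
  simp only [hh.map.add_comp, Category.assoc, hh.lam_comp_map, 𝕋.zero_comp_map,
    Category.id_comp] at e'
  simpa only [Category.assoc] using e'.symm

variable (S)

theorem lam_tangentObj (A : C) :
    S.lam (𝕋.T.obj A) = 𝕋.T.map (S.lam A) ≫ 𝕋.cflip A :=
  S.lam_tangent A

theorem isLinear_fst (A B : C) : S.IsLinear (fst A B) where
  toIsAdditive := S.isAdditive_fst A B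
  lam_comp_map := by rw [S.lam_prod]; simp

theorem isLinear_snd (A B : C) : S.IsLinear (snd A B) where
  toIsAdditive := S.isAdditive_snd A B
  lam_comp_map := by rw [S.lam_prod]; simp

/-- Both sides equal `λℓ`, because `ℓc = ℓ`. -/
theorem lam_map_lam_cflip (A : C) :
    S.lam A ≫ 𝕋.T.map (S.lam A) ≫ 𝕋.cflip A = S.lam A ≫ 𝕋.T.map (S.lam A) := by
  rw [← Category.assoc, ← lam_comp_vlift, Category.assoc, 𝕋.vlift_cflip]

theorem isLinear_lam (A : C) : S.IsLinear (S.lam A) where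
  toIsAdditive := S.isAdditive_lam A
  lam_comp_map := by rw [lam_tangentObj, lam_map_lam_cflip]

/-- Applying `T` to `1 = p̂λ + p0` and then composing with `c` gives `c = T(p̂)λ + T(p)0`, by
[CDS.2] and `T(0)c = 0`. -/
theorem cflip_comp_pHat (A : C) :
    𝕋.cflip A ≫ S.pHat (𝕋.T.obj A) = 𝕋.T.map (S.pHat A) := by
  apply S.comp_pHat_eq (b := 𝕋.T.map (𝕋.proj A))
  have e := S.comp_pHat_lam_add (𝟙 (𝕋.T.obj A))
  simp only [Category.id_comp] at e
  have e' := congrArg (fun t => 𝕋.T.map t ≫ 𝕋.cflip A) e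
  simp only [map_add, add_comp_cflip, Functor.map_comp, Category.assoc, 𝕋.map_zero_cflip] at e'
  rw [lam_tangentObj, e', CategoryTheory.Functor.map_id, Category.id_comp]

theorem isLinear_pHat (A : C) : S.IsLinear (S.pHat A) where
  toIsAdditive := S.isAdditive_pHat A
  lam_comp_map := by
    rw [lam_tangentObj, ← cflip_comp_pHat, Category.assoc]
    have h := 𝕋.cflip_cflip A
    rw [reassoc_of% h]
    -- Once the two flips cancel, the claim is that the linear map `λ` commutes with `p̂`.
    exact (S.isLinear_lam A).map_comp_pHat

theorem cflip_map_pHat_pHat (A : C) :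
    𝕋.cflip A ≫ 𝕋.T.map (S.pHat A) ≫ S.pHat A = 𝕋.T.map (S.pHat A) ≫ S.pHat A := by
  have h := S.cflip_comp_pHat A
  rw [(S.isLinear_pHat A).map_comp_pHat, reassoc_of% h, (S.isLinear_pHat A).map_comp_pHat]

/-- From `1 = p̂λ + p0` one gets `ℓ = p̂λT(λ) + p0T(0)`. Then `T(p̂)` kills the second term and
cancels `T(λ)`, so `ℓT(p̂) = p̂λ`. -/
theorem vlift_map_pHat_pHat (A : C) :
    𝕋.vlift A ≫ 𝕋.T.map (S.pHat A) ≫ S.pHat A = S.pHat A := by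
  have e := S.comp_pHat_lam_add (𝟙 (𝕋.T.obj A))
  simp only [Category.id_comp] at e
  have e' := congrArg (fun t => t ≫ 𝕋.vlift A) e
  simp only [add_comp_vlift, Category.assoc, lam_comp_vlift, 𝕋.zero_vlift,
    Category.id_comp] at e'
  rw [← e', ← Category.assoc, (S.isAdditive_pHat A).map.add_comp]
  simp only [Category.assoc, ← Functor.map_comp, lam_comp_pHat, tangentZero_comp_pHat, map_zero,
    comp_zero, add_zero, CategoryTheory.Functor.map_id, Category.comp_id]

/-! ### Fibrewise addition of tangent vectors -/

theorem add_fibre {X A : C} {u u' w w' : X ⟶ 𝕋.T.obj A}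
    (hu : u ≫ 𝕋.proj A = u' ≫ 𝕋.proj A) (hw : w ≫ 𝕋.proj A = w' ≫ 𝕋.proj A) :
    S.add u w ≫ 𝕋.proj A = S.add u' w' ≫ 𝕋.proj A := by
  rw [(S.isAdditive_proj A).add_comp, (S.isAdditive_proj A).add_comp, hu, hw]

/-- Fibrewise addition of tangent vectors commutes with addition of maps. -/
theorem tangentSum_add_add {X A : C} {u u' w w' : X ⟶ 𝕋.T.obj A}
    (hu : u ≫ 𝕋.proj A = u' ≫ 𝕋.proj A) (hw : w ≫ 𝕋.proj A = w' ≫ 𝕋.proj A) :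
    𝕋.tangentSum (S.add u w) (S.add u' w') (S.add_fibre hu hw) =
      S.add (𝕋.tangentSum u u' hu) (𝕋.tangentSum w w' hw) := by
  obtain ⟨z, rfl, rfl⟩ := exists_map_fst_snd 𝕋 u w
  obtain ⟨z', rfl, rfl⟩ := exists_map_fst_snd 𝕋 u' w'
  have hz : z ≫ 𝕋.proj (A ⊗ A) = z' ≫ 𝕋.proj (A ⊗ A) := by
    simp only [Category.assoc, 𝕋.proj_naturality] at hu hw
    apply CartesianMonoidalCategory.hom_ext
    · simpa only [Category.assoc] using hu
    · simpa only [Category.assoc] using hw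
  -- With both pairs assembled over `A × A`, the interchange law is preservation of fibrewise sums
  -- by `T(σ)` and by the two projections.
  simp only [← comp_map_σ, ← 𝕋.tangentSum_comp_map _ _ _ hz]

theorem mu_fibre {X A : C} (a b c : X ⟶ A) :
    (CartesianMonoidalCategory.lift a c ≫ S.mu A) ≫ 𝕋.proj A =
      (CartesianMonoidalCategory.lift b c ≫ S.mu A) ≫ 𝕋.proj A := by
  simp only [Category.assoc, mu_comp_proj, lift_snd]

/-- Interchange splits the fibrewise sum into `aλ` with `bλ`, where it is `(a + b)λ`, and `c0` with
itself, where it is `c0`. -/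
theorem tangentSum_mu {X A : C} (a b c : X ⟶ A) :
    𝕋.tangentSum (CartesianMonoidalCategory.lift a c ≫ S.mu A)
      (CartesianMonoidalCategory.lift b c ≫ S.mu A) (S.mu_fibre a b c) =
      CartesianMonoidalCategory.lift (S.add a b) c ≫ S.mu A := by
  simp only [comp_mu]
  rw [S.tangentSum_add_add (S.lam_fibre a b) rfl, tangentSum_lam, 𝕋.tangentSum_zero_zero]

theorem tangentSum_comp_pHat {X A : C} (u w : X ⟶ 𝕋.T.obj A) (h : u ≫ 𝕋.proj A = w ≫ 𝕋.proj A) :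
    𝕋.tangentSum u w h ≫ S.pHat A = S.add (u ≫ S.pHat A) (w ≫ S.pHat A) := by
  have key : ∀ t : X ⟶ 𝕋.T.obj A,
      CartesianMonoidalCategory.lift (t ≫ S.pHat A) (t ≫ 𝕋.proj A) ≫ S.mu A = t := fun t => by
    rw [comp_mu, comp_pHat_lam_add]
  have e := S.tangentSum_mu (u ≫ S.pHat A) (w ≫ S.pHat A) (u ≫ 𝕋.proj A)
  have hw := key w
  -- Both vectors are written in coordinates over the same base point, as `tangentSum_mu` requires.
  rw [← h] at hw
  simp only [key u, hw] at e
  rw [e, Category.assoc, mu_comp_pHat, lift_fst]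

/-! ### The differential combinator -/

/-- The differential combinator `D[f] = μT(f)p̂`. -/
noncomputable def deriv {A B : C} (f : A ⟶ B) : A ⊗ A ⟶ B :=
  S.mu A ≫ 𝕋.T.map f ≫ S.pHat B

theorem deriv_add {A B : C} (f g : A ⟶ B) :
    S.deriv (S.add f g) = S.add (S.deriv f) (S.deriv g) := by
  simp only [deriv, map_add, add_comp_pHat, comp_add]

theorem deriv_zero (A B : C) : S.deriv (S.zero A B) = S.zero (A ⊗ A) B := by
  simp only [deriv, map_zero, zero_comp_pHat, comp_zero]

theorem lift_add_comp_deriv {X A B : C} (a b c : X ⟶ A) (f : A ⟶ B) :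
    CartesianMonoidalCategory.lift (S.add a b) c ≫ S.deriv f =
      S.add (CartesianMonoidalCategory.lift a c ≫ S.deriv f)
        (CartesianMonoidalCategory.lift b c ≫ S.deriv f) := by
  have h := S.tangentSum_mu a b c
  simp only [deriv, ← reassoc_of% h]
  rw [← Category.assoc, 𝕋.tangentSum_comp_map, tangentSum_comp_pHat]
  simp only [Category.assoc]

/-- The pair `⟨0, a⟩` corresponds to the zero vector at `a`; `T(f)` sends it to the zero vector at
`af`, which `p̂` kills. -/
theorem lift_zero_comp_deriv {X A B : C} (a : X ⟶ A) (f : A ⟶ B) :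
    CartesianMonoidalCategory.lift (S.zero X A) a ≫ S.deriv f = S.zero X B := by
  rw [deriv, ← Category.assoc, comp_mu, (S.isAdditive_lam A).zero_comp, zero_add, Category.assoc]
  have h := 𝕋.zero_comp_map f
  rw [reassoc_of% h, tangentZero_comp_pHat, comp_zero, comp_zero]

theorem IsLinear.deriv_eq {S : CoherentDifferentialStructure 𝕋} {A B : C} {h : A ⟶ B}
    (hh : S.IsLinear h) : S.deriv h = fst A A ≫ h := by
  have e := S.mu_comp_pHat A
  rw [deriv, hh.map_comp_pHat, reassoc_of% e]

theorem deriv_comp_of_isLinear {A B E : C} (f : A ⟶ B) {h : B ⟶ E} (hh : S.IsLinear h) :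
    S.deriv (f ≫ h) = S.deriv f ≫ h := by
  simp only [deriv, Functor.map_comp, Category.assoc, hh.map_comp_pHat]

theorem deriv_lift {X A B : C} (f : X ⟶ A) (g : X ⟶ B) :
    S.deriv (CartesianMonoidalCategory.lift f g) =
      CartesianMonoidalCategory.lift (S.deriv f) (S.deriv g) := by
  apply CartesianMonoidalCategory.hom_ext
  · rw [← S.deriv_comp_of_isLinear _ (S.isLinear_fst A B), lift_fst, lift_fst]
  · rw [← S.deriv_comp_of_isLinear _ (S.isLinear_snd A B), lift_snd, lift_snd]

/-- The pair `⟨D[f], π₁f⟩` corresponds to `T(f)` under `A × A ≅ T(A)`. -/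
theorem lift_deriv_comp_mu {A B : C} (f : A ⟶ B) :
    CartesianMonoidalCategory.lift (S.deriv f) (snd A A ≫ f) ≫ S.mu B = S.mu A ≫ 𝕋.T.map f := by
  have h : snd A A ≫ f = (S.mu A ≫ 𝕋.T.map f) ≫ 𝕋.proj B := by
    rw [Category.assoc, 𝕋.proj_naturality, ← mu_comp_proj S, Category.assoc]
  rw [h, comp_mu, deriv, ← Category.assoc (S.mu A) (𝕋.T.map f), comp_pHat_lam_add]

theorem deriv_comp {A B E : C} (f : A ⟶ B) (g : B ⟶ E) :
    S.deriv (f ≫ g) =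
      CartesianMonoidalCategory.lift (S.deriv f) (snd A A ≫ f) ≫ S.deriv g := by
  have h := S.lift_deriv_comp_mu f
  rw [show S.deriv g = S.mu B ≫ 𝕋.T.map g ≫ S.pHat E from rfl, reassoc_of% h, deriv,
    Functor.map_comp, Category.assoc]

/-! ### Second derivatives -/

/-- The element of `T(T(A))` with the four given components. -/
def muMu {X A : C} (a b c d : X ⟶ A) : X ⟶ 𝕋.T.obj (𝕋.T.obj A) :=
  S.add (S.add (a ≫ S.lam A ≫ 𝕋.T.map (S.lam A)) (c ≫ 𝕋.zero A ≫ 𝕋.T.map (S.lam A)))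
    (S.add (b ≫ S.lam A ≫ 𝕋.T.map (𝕋.zero A)) (d ≫ 𝕋.zero A ≫ 𝕋.T.map (𝕋.zero A)))

theorem comp_mu_map_fst {X A B : C} (a c : X ⟶ A ⊗ B) :
    (CartesianMonoidalCategory.lift a c ≫ S.mu (A ⊗ B)) ≫ 𝕋.T.map (fst A B) =
      S.add (a ≫ fst A B ≫ S.lam A) (c ≫ fst A B ≫ 𝕋.zero A) := by
  rw [comp_mu, (S.isAdditive_fst A B).map.add_comp]
  simp only [Category.assoc, (S.isLinear_fst A B).lam_comp_map, 𝕋.zero_comp_map]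

theorem comp_mu_map_snd {X A B : C} (a c : X ⟶ A ⊗ B) :
    (CartesianMonoidalCategory.lift a c ≫ S.mu (A ⊗ B)) ≫ 𝕋.T.map (snd A B) =
      S.add (a ≫ snd A B ≫ S.lam B) (c ≫ snd A B ≫ 𝕋.zero B) := by
  rw [comp_mu, (S.isAdditive_snd A B).map.add_comp]
  simp only [Category.assoc, (S.isLinear_snd A B).lam_comp_map, 𝕋.zero_comp_map]

/-- The linear projections split `μ` of `A × A` into coordinates; `T(λ)` and `T(0)` then distribute
over the sums. -/
theorem comp_mu_map_mu {X A : C} (a b c d : X ⟶ A) :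
    CartesianMonoidalCategory.lift (CartesianMonoidalCategory.lift a b)
      (CartesianMonoidalCategory.lift c d) ≫ S.mu (A ⊗ A) ≫ 𝕋.T.map (S.mu A) =
      S.muMu a b c d := by
  rw [← Category.assoc, S.mu_eq A, map_add, comp_add, Functor.map_comp, Functor.map_comp,
    ← Category.assoc _ (𝕋.T.map (fst A A)), ← Category.assoc _ (𝕋.T.map (snd A A)),
    comp_mu_map_fst, comp_mu_map_snd, (S.isAdditive_lam A).map.add_comp,
    (S.isAdditive_tangentZero A).map.add_comp]
  simp only [lift_fst_assoc, lift_snd_assoc, Category.assoc]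
  rfl

theorem comp_deriv_deriv {X A B : C} (a b c d : X ⟶ A) (f : A ⟶ B) :
    CartesianMonoidalCategory.lift (CartesianMonoidalCategory.lift a b)
      (CartesianMonoidalCategory.lift c d) ≫ S.deriv (S.deriv f) =
      S.muMu a b c d ≫ 𝕋.T.map (𝕋.T.map f) ≫ 𝕋.T.map (S.pHat B) ≫ S.pHat B := by
  rw [← comp_mu_map_mu]
  simp only [deriv, Functor.map_comp, Category.assoc]

/-- The two surviving terms are lifts, since `λT(λ) = λℓ` and `0T(0) = 0ℓ`. -/
theorem muMu_zero_zero {X A : C} (a d : X ⟶ A) :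
    S.muMu a (S.zero X A) (S.zero X A) d =
      (CartesianMonoidalCategory.lift a d ≫ S.mu A) ≫ 𝕋.vlift A := by
  have h₁ : S.zero X A ≫ 𝕋.zero A ≫ 𝕋.T.map (S.lam A) = S.zero X _ := by
    rw [← Category.assoc, (S.isAdditive_tangentZero A).zero_comp,
      (S.isAdditive_lam A).map.zero_comp]
  have h₂ : S.zero X A ≫ S.lam A ≫ 𝕋.T.map (𝕋.zero A) = S.zero X _ := by
    rw [← Category.assoc, (S.isAdditive_lam A).zero_comp,
      (S.isAdditive_tangentZero A).map.zero_comp]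
  rw [muMu, h₁, h₂, add_zero, zero_add, comp_mu, add_comp_vlift, Category.assoc, Category.assoc,
    lam_comp_vlift, 𝕋.zero_vlift]

/-- The flip fixes `λT(λ)` and `0T(0)`, and exchanges `0T(λ)` with `λT(0)`. -/
theorem muMu_cflip {X A : C} (a b c d : X ⟶ A) :
    S.muMu a b c d ≫ 𝕋.cflip A = S.muMu a c b d := by
  have h₁ : 𝕋.zero A ≫ 𝕋.T.map (S.lam A) ≫ 𝕋.cflip A = S.lam A ≫ 𝕋.T.map (𝕋.zero A) := by
    have h := 𝕋.zero_comp_map (S.lam A)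
    rw [reassoc_of% h, 𝕋.zero_cflip]
  have h₂ : S.lam A ≫ 𝕋.T.map (𝕋.zero A) ≫ 𝕋.cflip A = 𝕋.zero A ≫ 𝕋.T.map (S.lam A) := by
    rw [𝕋.map_zero_cflip, 𝕋.zero_comp_map]
  have h₃ : 𝕋.zero A ≫ 𝕋.T.map (𝕋.zero A) ≫ 𝕋.cflip A = 𝕋.zero A ≫ 𝕋.T.map (𝕋.zero A) := by
    rw [𝕋.map_zero_cflip, 𝕋.zero_comp_map]
  simp only [muMu, add_comp_cflip, Category.assoc, lam_map_lam_cflip, h₁, h₂, h₃]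
  rw [add_add_add_comm]

theorem comp_deriv_deriv_zero {X A B : C} (a d : X ⟶ A) (f : A ⟶ B) :
    CartesianMonoidalCategory.lift (CartesianMonoidalCategory.lift a (S.zero X A))
      (CartesianMonoidalCategory.lift (S.zero X A) d) ≫ S.deriv (S.deriv f) =
      CartesianMonoidalCategory.lift a d ≫ S.deriv f := by
  have h := 𝕋.vlift_naturality f
  rw [comp_deriv_deriv, muMu_zero_zero, Category.assoc, ← reassoc_of% h, vlift_map_pHat_pHat,
    deriv, Category.assoc]

theorem comp_deriv_deriv_comm {X A B : C} (a b c d : X ⟶ A) (f : A ⟶ B) :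
    CartesianMonoidalCategory.lift (CartesianMonoidalCategory.lift a b)
      (CartesianMonoidalCategory.lift c d) ≫ S.deriv (S.deriv f) =
      CartesianMonoidalCategory.lift (CartesianMonoidalCategory.lift a c)
        (CartesianMonoidalCategory.lift b d) ≫ S.deriv (S.deriv f) := by
  have h := 𝕋.cflip_naturality f
  rw [comp_deriv_deriv, comp_deriv_deriv, ← muMu_cflip, Category.assoc, ← reassoc_of% h,
    cflip_map_pHat_pHat]

/-! ### The resulting Cartesian differential category. -/

/-- The Cartesian left additive structure of a coherent differential structure. -/
noncomputable abbrev cartesianLeftAdditive : CartesianLeftAdditive C where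
  homAddCommMonoid := S.homAddCommMonoid
  comp_add := S.comp_add
  comp_zero := fun f => S.comp_zero f _
  add_fst := fun f g => (S.isAdditive_fst _ _).add_comp f g
  zero_fst := fun X A B => (S.isAdditive_fst A B).zero_comp X
  add_snd := fun f g => (S.isAdditive_snd _ _).add_comp f g
  zero_snd := fun X A B => (S.isAdditive_snd A B).zero_comp X

/-- The Cartesian differential structure of a coherent differential structure. -/
noncomputable abbrev cartesianDifferential : CartesianDifferential C where
  toCartesianLeftAdditive := S.cartesianLeftAdditive
  D := S.deriv
  cd1_add := S.deriv_add
  cd1_zero := S.deriv_zero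
  cd2_add := S.lift_add_comp_deriv
  cd2_zero := S.lift_zero_comp_deriv
  cd3_fst := fun A B => (S.isLinear_fst A B).deriv_eq
  cd3_snd := fun A B => (S.isLinear_snd A B).deriv_eq
  cd4 := S.deriv_lift
  cd5 := S.deriv_comp
  cd6 := S.comp_deriv_deriv_zero
  cd7 := S.comp_deriv_deriv_comm

end CoherentDifferentialStructure

end Tangent

theorem mainTheorem2 {C : Type u} [Category.{v} C] [CartesianMonoidalCategory C]
    (𝕋 : Tangent.TangentStructure C) [PreservesFiniteProducts 𝕋.T]
    (S : Tangent.CoherentDifferentialStructure 𝕋) :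
    ∃ _ : Tangent.CartesianDifferential C,
      (∀ {A B : C} (f g : A ⟶ B), f + g = CartesianMonoidalCategory.lift f g ≫ S.σ B) ∧
      (∀ A B : C, (0 : A ⟶ B) = toUnit A ≫ S.ζ B) ∧
      (∀ {A B : C} (f : A ⟶ B),
        Tangent.CartesianDifferential.D f = S.mu A ≫ 𝕋.T.map f ≫ S.pHat B) :=
  ⟨S.cartesianDifferential, fun _ _ => rfl, fun _ _ => rfl, fun _ => rfl⟩
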